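/- Let $X$ be a complete metric space and let $S:\mathbb{R}^+\times X\to X$ be a continuous semiflow on $X$ ($S(0)x=x$, $S(t+s)x=S(t)S(s)x$) that is asymptotically compact: if $x_n\in X$ is a bounded sequence, $t_n\to+\infty$, and $S(t_n)x_n$ is bounded, then $S(t_n)x_n$ has a convergent subsequence. An attractor is a compact set $A$ with $S(t)A=A$ for all $t\ge 0$ that attracts some neighborhood $U$ of itself, i.e. for every $\varepsilon>0$ there is $T>0$ such that $S(t)U$ lies in the $\varepsilon$-neighborhood of $A$ for all $t>T$ (the empty set counts as an attractor). Let $\mathscr{A}$ be an attractor with attraction basin $\Omega=\{x\in X:\ d(S(t)x,\mathscr{A})\to 0 \text{ as } t\to\infty\}$, and let $\mathcal{M}=\{M_1,\dots,M_l\}$ be a Morse decomposition of $\mathscr{A}$: there are attractors $\emptyset=A_0\subsetneq A_1\subsetneq\cdots\subsetneq A_l=\mathscr{A}$ of the restricted semiflow $S|_{\mathscr{A}}$ such that $M_k=A_k\cap A_{k-1}^*$ for $1\le k\le l$, where $A_j^*=\{x\in\mathscr{A}:\ \omega(x)\cap A_j=\emptyset\}$ and $\omega(x)$ is the $\omega$-limit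 set of $x$. A strict Morse-Lyapunov (M-L) function of $\mathcal{M}$ is a continuous function $V:\Omega\to\mathbb{R}$ that is constant on each Morse set $M_k$, satisfies $V(M_1)<V(M_2)<\cdots<V(M_l)$, and is strictly decreasing along the semiflow outside the Morse sets: $V(S(t)x)<V(x)$ for all $x\in\Omega\setminus\bigcup_k M_k$ and all $t>0$. The numbers $V(M_1),\dots,V(M_l)$ are the generalized critical values of $V$; for $r\in\mathbb{R}$ put $V_r=\{x\in\Omega:\ V(x)\le r\}$. Let $H_*$ denote relative singular homology with coefficients in an arbitrary given abelian group. Let $V$ and $L$ be two strict M-L functions of $\mathcal{M}$, let $1\le k\le l$, and let $c=V(M_k)$, $c'=L(M_k)$. Assume that $a<c<b$ and $\alpha<c'<\beta$ are such that $c$ is the unique generalized critical value of $V$ in $[a,b]$ and $c'$ is the unique generalized critical value of $L$ in $[\alpha,\beta]$. Then $$H_q(V_b,V_a)\cong H_q(L_\beta,L_\alpha),\qquad q=0,1,2,\dots$$ That is, the critical groups $C_q(M_k)=H_q(V_b,V_a)$ of the Morse set $M_k$ do not depend on the choice of the strict M-L function (or of the isolating interval). -/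

import Mathlib

open Set Filter Topology NNReal

universe u v

section Dynamics

variable {X : Type u} [MetricSpace X]

/-- Asymptotic compactness of a semiflow (a `Flow` with time monoid `ℝ≥0`): if `x n` is a bounded
sequence, `t n → ∞` and the sequence `S (t n) (x n)` is bounded, then the latter has a convergent
subsequence. -/
def AsymptoticallyCompact (S : Flow ℝ≥0 X) : Prop :=
  ∀ (x : ℕ → X) (t : ℕ → ℝ≥0), Bornology.IsBounded (range x) → Tendsto t atTop atTop →
    Bornology.IsBounded (range fun n => S (t n) (x n)) →
    ∃ (y : X) (s : ℕ → ℕ), StrictMono s ∧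
      Tendsto (fun n => S (t (s n)) (x (s n))) atTop (𝓝 y)

/-- The set `A` attracts the set `B`. -/
def Attracts (S : Flow ℝ≥0 X) (A B : Set X) : Prop :=
  ∀ ε : ℝ, 0 < ε → ∃ T : ℝ≥0, 0 < T ∧ ∀ t : ℝ≥0, T < t → S t '' B ⊆ Metric.thickening ε A

/-- The attraction basin of `A`. The extended distance is used, so that the basin of the empty set
is empty. -/
def basin (S : Flow ℝ≥0 X) (A : Set X) : Set X :=
  {x | Tendsto (fun t : ℝ≥0 => Metric.infEDist (S t x) A) atTop (𝓝 0)}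

/-- An attractor: a compact set, invariant in the sense `S t '' A = A` for all `t`, which attracts
a neighborhood of itself. -/
structure IsAttractor (S : Flow ℝ≥0 X) (A : Set X) : Prop where
  isCompact : IsCompact A
  image_eq : ∀ t, S t '' A = A
  attracts : ∃ U : Set X, closure A ⊆ interior U ∧ Attracts S A U

lemma IsAttractor.isInvariant {S : Flow ℝ≥0 X} {K : Set X} (h : IsAttractor S K) :
    IsInvariant S K :=
  fun t => mapsTo_iff_image_subset.2 (h.image_eq t).subset

/-- `A` is an attractor of `S` in the attractor `K`, that is, a subset of `K` which is an attractor
of the semiflow `S` restricted to `K`. -/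
def IsAttractorIn (S : Flow ℝ≥0 X) {K : Set X} (hK : IsAttractor S K) (A : Set X) : Prop :=
  A ⊆ K ∧ IsAttractor (S.restrict hK.isInvariant) ((↑) ⁻¹' A : Set K)

/-- The repeller in `K` dual to `A`: the points of `K` whose `ω`-limit set does not meet `A`. -/
def dualRepeller (S : Flow ℝ≥0 X) (K A : Set X) : Set X :=
  {x | x ∈ K ∧ omegaLimit atTop S {x} ∩ A = ∅}

/-- `M` is a Morse decomposition of the attractor `K`: there are attractors
`∅ = A 0 ⊂ A 1 ⊂ ⋯ ⊂ A l = K` of `S` in `K`, with strict inclusions, such that each Morse set is the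
intersection of an `A j` with the repeller dual to the preceding one. The indices
`0, …, l - 1` of `M` stand for `1, …, l`. -/
def IsMorseDecomposition (S : Flow ℝ≥0 X) {K : Set X} (hK : IsAttractor S K) {l : ℕ}
    (M : Fin l → Set X) : Prop :=
  ∃ A : Fin (l + 1) → Set X, StrictMono A ∧ A 0 = ∅ ∧ A (Fin.last l) = K ∧
    (∀ j, IsAttractorIn S hK (A j)) ∧
    ∀ k : Fin l, M k = A k.succ ∩ dualRepeller S K (A k.castSucc)

/-- `V` (of which only the values on the basin of `K` matter) is a Morse-Lyapunov function of the
Morse decomposition `M` of `K`: it is continuous on the basin, constant on each Morse set, and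
strictly decreasing along the semiflow outside the union of the Morse sets. -/
structure IsMorseLyapunov (S : Flow ℝ≥0 X) (K : Set X) {l : ℕ} (M : Fin l → Set X)
    (V : X → ℝ) : Prop where
  continuousOn : ContinuousOn V (basin S K)
  constant : ∀ k, ∃ c : ℝ, ∀ x ∈ M k, V x = c
  decreasing : ∀ x ∈ basin S K \ ⋃ k, M k, ∀ t : ℝ≥0, 0 < t → V (S t x) < V x

/-- A strict Morse-Lyapunov function: the values on the Morse sets increase with the index. -/
structure IsStrictMorseLyapunov (S : Flow ℝ≥0 X) (K : Set X) {l : ℕ} (M : Fin l → Set X)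
    (V : X → ℝ) : Prop extends IsMorseLyapunov S K M V where
  lt_of_lt : ∀ i j, i < j → ∀ x ∈ M i, ∀ y ∈ M j, V x < V y

/-- The generalized critical values: the values of `V` on the Morse sets. -/
def genCriticalValues {l : ℕ} (M : Fin l → Set X) (V : X → ℝ) : Set ℝ :=
  V '' ⋃ k, M k

/-- The level set `{x ∈ Ω | V x ≤ a}`, with `Ω` the basin of `K`. -/
def levelSet (S : Flow ℝ≥0 X) (K : Set X) (V : X → ℝ) (a : ℝ) : Set X :=
  {x | x ∈ basin S K ∧ V x ≤ a}

lemma levelSet_subset (S : Flow ℝ≥0 X) (K : Set X) (V : X → ℝ) {a b : ℝ} (h : a ≤ b) :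
    levelSet S K V a ⊆ levelSet S K V b :=
  fun _ hx => ⟨hx.1, hx.2.trans h⟩

end Dynamics

section Homology

open CategoryTheory Limits

/-- The relative singular homology group `H_q(B, A; G)` of a pair `A ⊆ B` of subspaces of `X`: the
homology in degree `q` of the quotient of the singular chain complex of `B` by that of `A`, with
coefficients in the abelian group `G`. -/
noncomputable def relSingularHomology (G : Type v) [AddCommGroup G] {X : Type u}
    [TopologicalSpace X] {A B : Set X} (h : A ⊆ B) (q : ℕ) : AddCommGrpCat.{max u v} :=
  (cokernel (((AlgebraicTopology.singularChainComplexFunctor.{u} AddCommGrpCat.{max u v}).obj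
    (AddCommGrpCat.of (ULift.{u} G))).map
      (TopCat.ofHom (X := A) (Y := B) ⟨inclusion h, continuous_inclusion h⟩))).homology q

end Homology

/-! ### Morse sets and sublevel sets along the semiflow. -/

section Dynamics

variable {X : Type u} [MetricSpace X] {S : Flow ℝ≥0 X}

/-! Sublevel sets of a Morse-Lyapunov function are positively invariant, and each trajectory in the
basin accumulates at a point of a Morse set. Since `V` and `L` order the Morse sets alike and `c`,
`c'` are isolated, Morse points with `V ≤ b` satisfy `L < β`, and those with `V ≤ a` satisfy `L <
α`. So the flow carries `V_b` into `L_β` and `V_a` into `L_α`, in a time that is locally uniform; a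
partition of unity makes it a continuous function `τ` (`exists_continuous_time`). The maps `x ↦ S (τ
x) x` and its counterpart with `V` and `L` exchanged compose to flows for continuous times,
homotopic to the identity by scaling time (`homotopic_id_of_flow`). The five lemma passes from the
spaces to the pairs. -/

lemma tendsto_add_const_atTop (t : ℝ≥0) : Tendsto (fun s : ℝ≥0 => s + t) atTop atTop :=
  tendsto_atTop_mono (fun _ => le_self_add) tendsto_id

lemma subset_basin {K : Set X} (hK : IsInvariant S K) : K ⊆ basin S K := fun _ hx =>
  tendsto_const_nhds.congr fun t => (Metric.infEDist_zero_of_mem (hK t hx)).symm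

lemma isInvariant_basin (S : Flow ℝ≥0 X) (K : Set X) : IsInvariant S (basin S K) := fun t x hx => by
  have hx' : Tendsto (fun s : ℝ≥0 => Metric.infEDist (S s x) K) atTop (𝓝 0) := hx
  simpa only [basin, mem_ofPred_eq, Function.comp_def, Flow.map_add] using
    hx'.comp (tendsto_add_const_atTop t)

/-- A trajectory attracted by a compact set accumulates at a point of that set. -/
lemma exists_tendsto_of_mem_basin {K : Set X} (hK : IsCompact K) {x : X} (hx : x ∈ basin S K) :
    ∃ y ∈ K, ∃ t : ℕ → ℝ≥0, Tendsto t atTop atTop ∧ Tendsto (fun n => S (t n) x) atTop (𝓝 y) := by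
  have hx₀ : Tendsto (fun s : ℝ≥0 => Metric.infEDist (S s x) K) atTop (𝓝 0) := hx
  have hx' : Tendsto (fun n : ℕ => Metric.infEDist (S (n : ℝ≥0) x) K) atTop (𝓝 0) :=
    hx₀.comp tendsto_natCast_atTop_atTop
  rcases K.eq_empty_or_nonempty with rfl | hne
  -- The distance to the empty set is constantly `⊤`, so it cannot tend to `0`.
  · simp only [Metric.infEDist_empty] at hx'
    exact absurd (tendsto_nhds_unique hx' tendsto_const_nhds) ENNReal.zero_ne_top
  choose z hz hzd using fun n : ℕ => hK.exists_infEDist_eq_edist hne (S (n : ℝ≥0) x)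
  obtain ⟨y, hy, φ, hφ, hlim⟩ := hK.tendsto_subseq hz
  refine ⟨y, hy, fun n => φ n, tendsto_natCast_atTop_atTop.comp hφ.tendsto_atTop, ?_⟩
  have hd : Tendsto (fun n => edist (S (φ n : ℝ≥0) x) (z (φ n))) atTop (𝓝 0) := by
    simpa only [Function.comp_def, hzd] using hx'.comp hφ.tendsto_atTop
  rw [tendsto_iff_edist_tendsto_0] at hlim ⊢
  refine tendsto_of_tendsto_of_tendsto_of_le_of_le tendsto_const_nhds
    (by simpa using hd.add hlim) (fun _ => zero_le) (fun n => edist_triangle _ _ _)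

lemma IsMorseDecomposition.subset {K : Set X} {hK : IsAttractor S K} {l : ℕ} {M : Fin l → Set X}
    (hM : IsMorseDecomposition S hK M) (j : Fin l) : M j ⊆ K := by
  obtain ⟨A, -, -, -, -, hMA⟩ := hM
  rw [hMA]
  exact fun x hx => hx.2.1

lemma IsMorseDecomposition.isInvariant {K : Set X} {hK : IsAttractor S K} {l : ℕ}
    {M : Fin l → Set X} (hM : IsMorseDecomposition S hK M) (j : Fin l) : IsInvariant S (M j) := by
  obtain ⟨A, -, -, -, hA, hMA⟩ := hM
  intro t x hx
  rw [hMA] at hx ⊢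
  obtain ⟨hxA, hxK, hω⟩ := hx
  refine ⟨(hA j.succ).2.isInvariant t (x := ⟨x, hxK⟩) hxA, hK.isInvariant t hxK, ?_⟩
  -- The `ω`-limit set of `S t x` lies in that of `x`, which misses the attractor.
  refine subset_empty_iff.1 ((inter_subset_inter_left _ ?_).trans hω.subset)
  rw [← image_singleton]
  exact S.omegaLimit_image_subset atTop {x} t (tendsto_add_const_atTop t)

variable {K : Set X} {hK : IsAttractor S K} {l : ℕ} {M : Fin l → Set X} {V : X → ℝ}

lemma IsMorseLyapunov.map_le (hV : IsMorseLyapunov S K M V) (hM : IsMorseDecomposition S hK M)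
    {x : X} (hx : x ∈ basin S K) (t : ℝ≥0) : V (S t x) ≤ V x := by
  by_cases h : x ∈ ⋃ k, M k
  · obtain ⟨j, hj⟩ := mem_iUnion.1 h
    obtain ⟨c, hc⟩ := hV.constant j
    rw [hc _ hj, hc _ (hM.isInvariant j t hj)]
  · rcases eq_or_ne t 0 with rfl | ht
    · rw [Flow.map_zero_apply]
    · exact (hV.decreasing x ⟨hx, h⟩ t (pos_iff_ne_zero.2 ht)).le

lemma IsMorseLyapunov.isInvariant_levelSet (hV : IsMorseLyapunov S K M V)
    (hM : IsMorseDecomposition S hK M) (a : ℝ) : IsInvariant S (levelSet S K V a) :=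
  fun t _ hx => ⟨isInvariant_basin S K t hx.1, (hV.map_le hM hx.1 t).trans hx.2⟩

/-- Trajectories in the basin accumulate at a point of some Morse set. -/
lemma IsMorseLyapunov.exists_tendsto (hV : IsMorseLyapunov S K M V)
    (hM : IsMorseDecomposition S hK M) {x : X} (hx : x ∈ basin S K) :
    ∃ j, ∃ y ∈ M j, V y ≤ V x ∧
      ∃ t : ℕ → ℝ≥0, Tendsto (fun n => S (t n) x) atTop (𝓝[basin S K] y) := by
  obtain ⟨y, hy, t, ht, hlim⟩ := exists_tendsto_of_mem_basin hK.isCompact hx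
  have hyΩ := subset_basin hK.isInvariant hy
  have hlimΩ {s : ℕ → ℝ≥0} {z : X} (h : Tendsto (fun n => S (s n) x) atTop (𝓝 z)) :
      Tendsto (fun n => S (s n) x) atTop (𝓝[basin S K] z) :=
    tendsto_nhdsWithin_iff.2 ⟨h, .of_forall fun n => isInvariant_basin S K _ hx⟩
  have hVlim : Tendsto (fun n => V (S (t n) x)) atTop (𝓝 (V y)) :=
    (hV.continuousOn y hyΩ).tendsto.comp (hlimΩ hlim)
  have hanti : Antitone fun s : ℝ≥0 => V (S s x) := fun r s hrs => by
    obtain ⟨d, rfl⟩ := exists_add_of_le hrs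
    simp only [add_comm r d, Flow.map_add]
    exact hV.map_le hM (isInvariant_basin S K r hx) d
  have hle (s : ℝ≥0) : V y ≤ V (S s x) :=
    le_of_tendsto hVlim ((ht.eventually_ge_atTop s).mono fun n hn => hanti hn)
  -- LaSalle's argument: `S 1 y` is also an accumulation point of the trajectory, so `V y ≤ V (S 1
  -- y)`, which strict decrease forbids outside the Morse sets.
  have hyM : y ∈ ⋃ k, M k := by
    by_contra hyM
    refine (hV.decreasing y ⟨hyΩ, hyM⟩ 1 one_pos).not_ge ?_
    have h1 : Tendsto (fun n => S (1 + t n) x) atTop (𝓝 (S 1 y)) := by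
      simp only [Flow.map_add]
      exact ((S.continuous_toFun 1).tendsto y).comp hlim
    exact ge_of_tendsto ((hV.continuousOn _ (isInvariant_basin S K 1 hyΩ)).tendsto.comp (hlimΩ h1))
      (.of_forall fun n => hle _)
  obtain ⟨j, hj⟩ := mem_iUnion.1 hyM
  exact ⟨j, y, hj, by simpa using hle 0, t, hlimΩ hlim⟩

/-- If the Morse sets in `{V ≤ b}` lie in `{L < β}`, then the trajectories starting near a point of
`{V ≤ b}` enter `{L ≤ β}` at a common time. -/
lemma IsMorseLyapunov.exists_eventually_mem_levelSet {L : X → ℝ} (hV : IsMorseLyapunov S K M V)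
    (hL : IsMorseLyapunov S K M L) (hM : IsMorseDecomposition S hK M) {b β : ℝ}
    (h : ∀ j, ∀ y ∈ M j, V y ≤ b → L y < β) {x : X} (hx : x ∈ levelSet S K V b) :
    ∃ t : ℝ≥0, ∀ᶠ y in 𝓝[basin S K] x, S t y ∈ levelSet S K L β := by
  obtain ⟨j, y, hy, hyx, t, ht⟩ := hV.exists_tendsto hM hx.1
  have hyΩ := subset_basin hK.isInvariant (hM.subset j hy)
  obtain ⟨n, hn⟩ := (((hL.continuousOn y hyΩ).tendsto.comp ht).eventually_lt_const
    (h j y hy (hyx.trans hx.2))).exists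
  have hcont : ContinuousOn (fun z => L (S (t n) z)) (basin S K) :=
    hL.continuousOn.comp (S.continuous_toFun _).continuousOn (isInvariant_basin S K (t n))
  refine ⟨t n, ?_⟩
  filter_upwards [(hcont x hx.1).eventually_lt_const hn, self_mem_nhdsWithin] with z hz hzΩ
  exact ⟨isInvariant_basin S K _ hzΩ, hz.le⟩

/-- Two strict Morse-Lyapunov functions order the Morse sets in the same way. -/
lemma IsStrictMorseLyapunov.le_of_le {L : X → ℝ} (hV : IsStrictMorseLyapunov S K M V)
    (hL : IsStrictMorseLyapunov S K M L) {i j : Fin l} {x y : X} (hx : x ∈ M i) (hy : y ∈ M j)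
    (h : V x ≤ V y) : L x ≤ L y := by
  rcases lt_trichotomy i j with hij | rfl | hij
  · exact (hL.lt_of_lt i j hij x hx y hy).le
  · obtain ⟨c, hc⟩ := hL.constant i
    rw [hc x hx, hc y hy]
  · exact absurd h (hV.lt_of_lt j i hij y hy x hx).not_ge

/-- Uniqueness for `V` forces `V y ≤ c`, and the common ordering gives `L y ≤ c'`. -/
lemma IsStrictMorseLyapunov.lt_of_le_upper {L : X → ℝ} (hV : IsStrictMorseLyapunov S K M V)
    (hL : IsStrictMorseLyapunov S K M L) {k : Fin l} {c c' a b β : ℝ} (hc : V '' M k = {c})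
    (hc' : L '' M k = {c'}) (hac : a < c) (hβ : c' < β)
    (huniq : genCriticalValues M V ∩ Icc a b = {c}) (j : Fin l) (y : X) (hy : y ∈ M j)
    (hyb : V y ≤ b) : L y < β := by
  obtain ⟨z, hz, rfl⟩ := hc.ge (mem_singleton c)
  have hLz : L z = c' := hc'.le (mem_image_of_mem L hz)
  refine ((hV.le_of_le hL hy hz ?_).trans hLz.le).trans_lt hβ
  by_contra! hlt
  exact hlt.ne' (huniq.le ⟨⟨y, mem_iUnion.2 ⟨j, hy⟩, rfl⟩, (hac.trans hlt).le, hyb⟩)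

/-- Here `V y < c`, so the common ordering gives `L y < c'`; uniqueness for `L` then excludes `α ≤ L
y`. -/
lemma IsStrictMorseLyapunov.lt_of_le_lower {L : X → ℝ} (hV : IsStrictMorseLyapunov S K M V)
    (hL : IsStrictMorseLyapunov S K M L) {k : Fin l} {c c' a α β : ℝ} (hc : V '' M k = {c})
    (hc' : L '' M k = {c'}) (hac : a < c) (hβ : c' < β)
    (huniq : genCriticalValues M L ∩ Icc α β = {c'}) (j : Fin l) (y : X) (hy : y ∈ M j)
    (hya : V y ≤ a) : L y < α := by
  obtain ⟨z, hz, rfl⟩ := hc.ge (mem_singleton c)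
  have hLz : L z = c' := hc'.le (mem_image_of_mem L hz)
  have hlt : L y < c' := by
    by_contra! h
    exact (hya.trans_lt hac).not_ge (hL.le_of_le hV hz hy (hLz.le.trans h))
  by_contra! hαy
  exact hlt.ne (huniq.le ⟨⟨y, mem_iUnion.2 ⟨j, hy⟩, rfl⟩, hαy, (hlt.trans hβ).le⟩)

/-- A continuous choice of times at which the flow sends the pair `(B, A)` into `(B', A')`. -/
lemma exists_continuous_time {A B A' B' : Set X} (hA' : IsInvariant S A') (hB' : IsInvariant S B')
    (hA'B' : A' ⊆ B') (hclosed : IsClosed ((↑) ⁻¹' A : Set B))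
    (hB : ∀ x ∈ B, ∃ t : ℝ≥0, ∀ᶠ y in 𝓝[B] x, S t y ∈ B')
    (hA : ∀ x ∈ A, ∃ t : ℝ≥0, ∀ᶠ y in 𝓝[B] x, S t y ∈ A') :
    ∃ τ : C(B, ℝ≥0), ∀ x : B, S (τ x) x ∈ B' ∧ (x.1 ∈ A → S (τ x) x ∈ A') := by
  -- By invariance of the targets, admissible times form an up-closed set of reals, hence a convex
  -- one, so local choices can be averaged by a partition of unity.
  let good (x : B) : Set ℝ :=
    {r | 0 ≤ r ∧ S r.toNNReal x ∈ B' ∧ (x.1 ∈ A → S r.toNNReal x ∈ A')}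
  have hmono (x : B) : ∀ r ∈ good x, ∀ s, r ≤ s → s ∈ good x := by
    rintro r ⟨hr, hrB, hrA⟩ s hrs
    have key : S s.toNNReal x = S (s.toNNReal - r.toNNReal) (S r.toNNReal x) := by
      rw [← Flow.map_add, tsub_add_cancel_of_le (Real.toNNReal_le_toNNReal hrs)]
    refine ⟨hr.trans hrs, ?_, fun hx => ?_⟩ <;> rw [key]
    exacts [hB' _ hrB, hA' _ (hrA hx)]
  have hconv (x : B) : Convex ℝ (good x) :=
    OrdConnected.convex ⟨fun r hr s _ z hz => hmono x r hr z hz.1⟩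
  obtain ⟨g, hg⟩ := exists_continuous_forall_mem_convex_of_local_const hconv fun x => by
    -- Near a point of `A`, a time into `A'` serves all neighbours, as `A' ⊆ B'`. Off `A`, which is
    -- closed in `B`, only `B'` matters.
    by_cases hx : x.1 ∈ A
    · obtain ⟨t, ht⟩ := hA x hx
      refine ⟨t, ?_⟩
      filter_upwards [(eventually_nhds_subtype_iff B x (fun y => S t y ∈ A')).2 ht] with y hy
      simpa [good] using ⟨hA'B' hy, fun _ => hy⟩
    · obtain ⟨t, ht⟩ := hB x x.2
      refine ⟨t, ?_⟩
      filter_upwards [(eventually_nhds_subtype_iff B x (fun y => S t y ∈ B')).2 ht,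
        hclosed.isOpen_compl.mem_nhds hx] with y hy hyA
      simpa [good] using ⟨hy, fun h => absurd h hyA⟩
  exact ⟨⟨fun x => (g x).toNNReal, by fun_prop⟩, fun x => (hg x).2⟩

/-- Moving each point of a positively invariant set along the flow, for a time which depends
continuously on the point, is homotopic to the identity. -/
lemma homotopic_id_of_flow {B : Set X} (hB : IsInvariant S B) (σ : C(B, ℝ≥0)) (h : C(B, B))
    (hh : ∀ x, (h x : X) = S (σ x) x) : (ContinuousMap.id B).Homotopic h :=
  ⟨{  toFun := fun p => ⟨S (Real.toNNReal p.1 * σ p.2) p.2, hB _ p.2.2⟩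
      continuous_toFun := by
        refine Continuous.subtype_mk (S.continuous ?_ (by fun_prop)) _
        fun_prop
      map_zero_left := fun x => by ext; simp
      map_one_left := fun x => by ext; simp [hh] }⟩

end Dynamics

/-! ### Homology of pairs. -/

section Homology

open CategoryTheory Limits AlgebraicTopology

/-- A morphism of monomorphisms of chain complexes which consists of quasi-isomorphisms induces
isomorphisms on the homology of the cokernels. -/
lemma nonempty_homology_cokernel_iso {C : Type*} [Category* C] [Abelian C]
    {K₁ K₂ L₁ L₂ : ChainComplex C ℕ} (i : K₁ ⟶ K₂) (j : L₁ ⟶ L₂) [Mono i] [Mono j]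
    (f₁ : K₁ ⟶ L₁) (f₂ : K₂ ⟶ L₂) (comm : i ≫ f₂ = f₁ ≫ j) [QuasiIso f₁] [QuasiIso f₂] (q : ℕ) :
    Nonempty ((cokernel i).homology q ≅ (cokernel j).homology q) := by
  let φ : ShortComplex.cokernelSequence i ⟶ ShortComplex.cokernelSequence j :=
    { τ₁ := f₁
      τ₂ := f₂
      τ₃ := cokernel.map i j f₁ f₂ comm
      comm₁₂ := comm.symm
      comm₂₃ := by simp [ShortComplex.cokernelSequence] }
  have hi : (ShortComplex.cokernelSequence i).ShortExact :=
    { exact := ShortComplex.cokernelSequence_exact i, mono_f := ‹Mono i› }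
  have hj : (ShortComplex.cokernelSequence j).ShortExact :=
    { exact := ShortComplex.cokernelSequence_exact j, mono_f := ‹Mono j› }
  -- Five lemma in the long exact homology sequences.
  have : QuasiIso φ.τ₃ := HomologicalComplex.HomologySequence.quasiIso_τ₃ φ hi hj
    (inferInstanceAs (QuasiIso f₁)) (inferInstanceAs (QuasiIso f₂))
  exact ⟨isoOfQuasiIsoAt φ.τ₃ q⟩

variable {C : Type*} [Category* C] [HasCoproducts.{u} C]

/-- Chains are coproducts of copies of `R` indexed by singular simplices, and `f` is injective on
simplices. -/
lemma mono_singularChainComplexFunctor_map [Abelian C] (R : C) {Y Z : TopCat.{u}} (f : Y ⟶ Z)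
    [Mono f] : Mono (((singularChainComplexFunctor C).obj R).map f) := by
  refine HomologicalComplex.mono_of_mono_f _ fun n => ?_
  have hinj : Function.Injective ((TopCat.toSSet.map f).app (.op (.mk n))) :=
    (mono_iff_injective _).1 inferInstance
  exact MonoCoprod.mono_map'_of_injective (fun _ => R) _ hinj

lemma quasiIso_singularChainComplexFunctor_map [Preadditive C] [CategoryWithHomology C] (R : C)
    {Y Z : TopCat.{u}} (f : Y ⟶ Z) (g : Z ⟶ Y)
    (hfg : (ContinuousMap.id Y).Homotopic (g.hom.comp f.hom))
    (hgf : (ContinuousMap.id Z).Homotopic (f.hom.comp g.hom)) :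
    QuasiIso (((singularChainComplexFunctor C).obj R).map f) := by
  let F := (singularChainComplexFunctor C).obj R
  obtain ⟨H₁⟩ := hfg
  obtain ⟨H₂⟩ := hgf
  have h₁ : Homotopy (F.map (𝟙 Y)) (F.map (f ≫ g)) :=
    TopCat.Homotopy.singularChainComplexFunctorObjMap H₁ R
  have h₂ : Homotopy (F.map (𝟙 Z)) (F.map (g ≫ f)) :=
    TopCat.Homotopy.singularChainComplexFunctorObjMap H₂ R
  let e : HomotopyEquiv (F.obj Y) (F.obj Z) :=
    { hom := F.map f
      inv := F.map g
      homotopyHomInvId := (Homotopy.ofEq (F.map_comp f g).symm).trans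
        (h₁.symm.trans (Homotopy.ofEq (F.map_id Y)))
      homotopyInvHomId := (Homotopy.ofEq (F.map_comp g f).symm).trans
        (h₂.symm.trans (Homotopy.ofEq (F.map_id Z))) }
  exact homotopyEquivalences_le_quasiIso C _ _ ⟨e, rfl⟩

/-- The homotopies on `A` and `B` need not be compatible: the five lemma only asks that both maps be
quasi-isomorphisms on chains. -/
lemma nonempty_relSingularHomology_iso (G : Type v) [AddCommGroup G] {X Y : Type u}
    [TopologicalSpace X] [TopologicalSpace Y] {A B : Set X} {A' B' : Set Y} (h : A ⊆ B)
    (h' : A' ⊆ B') (f : C(B, B')) (g : C(B', B)) (fA : C(A, A')) (gA : C(A', A))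
    (hf : ∀ x, (f (inclusion h x) : Y) = fA x)
    (hgf : (ContinuousMap.id B).Homotopic (g.comp f))
    (hfg : (ContinuousMap.id B').Homotopic (f.comp g))
    (hgfA : (ContinuousMap.id A).Homotopic (gA.comp fA))
    (hfgA : (ContinuousMap.id A').Homotopic (fA.comp gA)) (q : ℕ) :
    Nonempty (relSingularHomology G h q ≅ relSingularHomology G h' q) := by
  let F := (singularChainComplexFunctor.{u} AddCommGrpCat.{max u v}).obj
    (AddCommGrpCat.of (ULift.{u} G))
  let i : TopCat.of A ⟶ TopCat.of B := TopCat.ofHom ⟨inclusion h, continuous_inclusion h⟩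
  let j : TopCat.of A' ⟶ TopCat.of B' := TopCat.ofHom ⟨inclusion h', continuous_inclusion h'⟩
  have : Mono i := (TopCat.mono_iff_injective i).2 (inclusion_injective h)
  have : Mono j := (TopCat.mono_iff_injective j).2 (inclusion_injective h')
  have : Mono (F.map i) := mono_singularChainComplexFunctor_map _ i
  have : Mono (F.map j) := mono_singularChainComplexFunctor_map _ j
  have : QuasiIso (F.map (TopCat.ofHom fA)) :=
    quasiIso_singularChainComplexFunctor_map _ _ (TopCat.ofHom gA) hgfA hfgA
  have : QuasiIso (F.map (TopCat.ofHom f)) :=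
    quasiIso_singularChainComplexFunctor_map _ _ (TopCat.ofHom g) hgf hfg
  refine nonempty_homology_cokernel_iso (F.map i) (F.map j) (F.map (TopCat.ofHom fA))
    (F.map (TopCat.ofHom f)) ?_ q
  rw [← F.map_comp, ← F.map_comp]
  congr 1
  ext x
  exact hf x

end Homology

/-! ### Comparison of the two sublevel pairs. -/

section Flow

variable {X : Type u} [MetricSpace X] {S : Flow ℝ≥0 X}

/-- The map given by moving along the flow for a time depending on the point. -/
def flowMap (S : Flow ℝ≥0 X) {B B' : Set X} (τ : C(B, ℝ≥0)) (h : ∀ x : B, S (τ x) x ∈ B') :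
    C(B, B') where
  toFun x := ⟨S (τ x) x, h x⟩
  continuous_toFun := (S.continuous (by fun_prop) (by fun_prop)).subtype_mk _

lemma homotopic_id_flowMap_comp {B B' : Set X} (hB : IsInvariant S B) (τ : C(B, ℝ≥0))
    (h : ∀ x : B, S (τ x) x ∈ B') (τ' : C(B', ℝ≥0)) (h' : ∀ x : B', S (τ' x) x ∈ B) :
    (ContinuousMap.id B).Homotopic ((flowMap S τ' h').comp (flowMap S τ h)) :=
  -- By the semigroup law, the composite is the flow for the sum of the two times.
  homotopic_id_of_flow hB ⟨fun x => τ' (flowMap S τ h x) + τ x, by fun_prop⟩ _ fun _ =>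
    (S.map_add _ _ _).symm

lemma nonempty_relSingularHomology_iso_of_flow (G : Type v) [AddCommGroup G] {A B A' B' : Set X}
    (h : A ⊆ B) (h' : A' ⊆ B') (hA : IsInvariant S A) (hB : IsInvariant S B)
    (hA' : IsInvariant S A') (hB' : IsInvariant S B')
    (τ : C(B, ℝ≥0)) (hτ : ∀ x : B, S (τ x) x ∈ B' ∧ (x.1 ∈ A → S (τ x) x ∈ A'))
    (τ' : C(B', ℝ≥0)) (hτ' : ∀ x : B', S (τ' x) x ∈ B ∧ (x.1 ∈ A' → S (τ' x) x ∈ A)) (q : ℕ) :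
    Nonempty (CategoryTheory.Iso (relSingularHomology G h q) (relSingularHomology G h' q)) := by
  let τA : C(A, ℝ≥0) := τ.comp ⟨inclusion h, continuous_inclusion h⟩
  let τA' : C(A', ℝ≥0) := τ'.comp ⟨inclusion h', continuous_inclusion h'⟩
  have hτA (x : A) : S (τA x) x ∈ A' := (hτ (inclusion h x)).2 x.2
  have hτA' (x : A') : S (τA' x) x ∈ A := (hτ' (inclusion h' x)).2 x.2
  exact nonempty_relSingularHomology_iso G h h' (flowMap S τ fun x => (hτ x).1)
    (flowMap S τ' fun x => (hτ' x).1) (flowMap S τA hτA) (flowMap S τA' hτA') (fun _ => rfl)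
    (homotopic_id_flowMap_comp hB _ _ _ _) (homotopic_id_flowMap_comp hB' _ _ _ _)
    (homotopic_id_flowMap_comp hA _ _ _ _) (homotopic_id_flowMap_comp hA' _ _ _ _) q

/-- The flow carries sublevel pairs of one strict Morse-Lyapunov function into those of another. -/
lemma IsStrictMorseLyapunov.exists_continuous_time {K : Set X} {hK : IsAttractor S K} {l : ℕ}
    {M : Fin l → Set X} (hM : IsMorseDecomposition S hK M) {V L : X → ℝ}
    (hV : IsStrictMorseLyapunov S K M V) (hL : IsStrictMorseLyapunov S K M L) {k : Fin l}
    {c c' : ℝ} (hc : V '' M k = {c}) (hc' : L '' M k = {c'}) {a b α β : ℝ} (hac : a < c)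
    (hαc' : α < c') (hc'β : c' < β) (huniqV : genCriticalValues M V ∩ Icc a b = {c})
    (huniqL : genCriticalValues M L ∩ Icc α β = {c'}) :
    ∃ τ : C(levelSet S K V b, ℝ≥0), ∀ x, S (τ x) x ∈ levelSet S K L β ∧
      (x.1 ∈ levelSet S K V a → S (τ x) x ∈ levelSet S K L α) := by
  have hsub : levelSet S K V b ⊆ basin S K := fun _ hx => hx.1
  refine _root_.exists_continuous_time (hL.isInvariant_levelSet hM α)
    (hL.isInvariant_levelSet hM β) (levelSet_subset S K L (hαc'.trans hc'β).le) ?_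
    (fun x hx => ?_) (fun x hx => ?_)
  · have hcont : Continuous fun x : levelSet S K V b => V x :=
      (hV.continuousOn.mono hsub).domRestrict
    convert isClosed_le hcont continuous_const using 1
    exact Set.ext fun x => ⟨fun hx => hx.2, fun hx => ⟨x.2.1, hx⟩⟩
  · obtain ⟨t, ht⟩ := hV.exists_eventually_mem_levelSet hL.toIsMorseLyapunov hM
      (hV.lt_of_le_upper hL hc hc' hac hc'β huniqV) hx
    exact ⟨t, ht.filter_mono (nhdsWithin_mono x hsub)⟩
  · obtain ⟨t, ht⟩ := hV.exists_eventually_mem_levelSet hL.toIsMorseLyapunov hM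
      (hV.lt_of_le_lower hL hc hc' hac hc'β huniqL) hx
    exact ⟨t, ht.filter_mono (nhdsWithin_mono x hsub)⟩

end Flow

theorem propositionp {X : Type u} [MetricSpace X] [CompleteSpace X]
    (S : Flow ℝ≥0 X) (hS : AsymptoticallyCompact S)
    {K : Set X} (hK : IsAttractor S K)
    {l : ℕ} {M : Fin l → Set X} (hM : IsMorseDecomposition S hK M)
    {V L : X → ℝ} (hV : IsStrictMorseLyapunov S K M V) (hL : IsStrictMorseLyapunov S K M L)
    (k : Fin l) {c c' : ℝ} (hc : V '' M k = {c}) (hc' : L '' M k = {c'})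
    {a b α β : ℝ} (hac : a < c) (hcb : c < b) (hαc' : α < c') (hc'β : c' < β)
    (huniqV : genCriticalValues M V ∩ Icc a b = {c})
    (huniqL : genCriticalValues M L ∩ Icc α β = {c'})
    (G : Type v) [AddCommGroup G] (q : ℕ) :
    Nonempty (CategoryTheory.Iso
      (relSingularHomology G (levelSet_subset S K V (hac.trans hcb).le) q)
      (relSingularHomology G (levelSet_subset S K L (hαc'.trans hc'β).le) q)) := by
  obtain ⟨τ, hτ⟩ := hV.exists_continuous_time hM hL hc hc' hac hαc' hc'β huniqV huniqL
  obtain ⟨τ', hτ'⟩ := hL.exists_continuous_time hM hV hc' hc hαc' hac hcb huniqL huniqV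
  exact nonempty_relSingularHomology_iso_of_flow G _ _ (hV.isInvariant_levelSet hM a)
    (hV.isInvariant_levelSet hM b) (hL.isInvariant_levelSet hM α) (hL.isInvariant_levelSet hM β)
    τ hτ τ' hτ' q
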